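/- Let $d\ge 1$ and $s\in(0,1]$. For $x\in\mathbb Z^d$ let $|x|=(x_1^2+\dots+x_d^2)^{1/2}$, and put $\mathbb T^d=[-\pi,\pi]^d$ and $\omega(\xi)=4\sum_{j=1}^d\sin^2(\xi_j/2)$. For $f\in\ell^1(\mathbb Z^d)$ (complex-valued) let $\widehat f(\xi)=(2\pi)^{-d/2}\sum_{x\in\mathbb Z^d}f(x)e^{-i\langle x,\xi\rangle}$, and let $(-\Delta)^s$ be the fractional power of the discrete Laplacian on $\mathbb Z^d$, defined as the Fourier multiplier $\widehat{(-\Delta)^sf}(\xi)=\omega(\xi)^s\widehat f(\xi)$, $\xi\in\mathbb T^d$. For $t\ge0$ and $x\in\mathbb Z^d$ let \[ G_t^{(s)}(x)=\frac1{(2\pi)^d}\int_{\mathbb T^d}e^{-t\omega(\xi)^s}e^{i\langle x,\xi\rangle}\,d\xi . \] For every $u_0\in\ell^1(\mathbb Z^d)$ the Cauchy problem \[ \partial_tu+(-\Delta)^su=0\quad(t>0),\qquad u(0)=u_0, \] has a unique solution $u$ in $\ell^1(\mathbb Z^d)$ (continuous on $[0,\infty)$ and differentiable on $(0,\infty)$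 as an $\ell^1(\mathbb Z^d)$-valued function), and it is given by \[ u(t,x)=(G_t^{(s)}*u_0)(x)=\sum_{y\in\mathbb Z^d}G_t^{(s)}(x-y)\,u_0(y),\qquad t\ge0,\ x\in\mathbb Z^d . \] Moreover, there is a constant $C=C(d,s)>0$ such that the following holds for every $u_0\in\ell^1(\mathbb Z^d)$ with finite first moment $\mathcal N_1(u_0)=\sum_{x\in\mathbb Z^d}|x|\,|u_0(x)|<\infty$. Let $M=\sum_{x\in\mathbb Z^d}u_0(x)$, and let $u(t)=u(t,\cdot)$ be the solution above. Then, for all $t>0$, \[ t^{\frac d{2s}}\,\|u(t)-M G_t^{(s)}\|_{\ell^\infty(\mathbb Z^d)}\le C\,\mathcal N_1(u_0)\,t^{-\frac1{2s}}, \qquad \|u(t)-M G_t^{(s)}\|_{\ell^1(\mathbb Z^d)}\le C\,\mathcal N_1(u_0)\,t^{-\frac1{2s}}, \] and, for every $1\le p\le\infty$ (with the same constant $C$, and $1/\infty=0$), \[ t^{\frac d{2s}\left(1-\frac1p\right)}\,\|u(t)-M G_t^{(s)}\|_{\ell^p(\mathbb Z^d)}\le C\,\mathcal N_1(u_0)\,t^{-\frac1{2s}}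 . \] -/

import Mathlib

noncomputable section

namespace LatticeDiffusion

/-- The space `ℓ^p(ℤᵈ)` of complex sequences, with its usual norm. -/
abbrev Ell (d : ℕ) (p : ENNReal) : Type := lp (fun _ : Fin d → ℤ => ℂ) p

/-- The pairing `⟨x, ξ⟩ = ∑ⱼ xⱼ ξⱼ` of a lattice point with a frequency. -/
def pairing {d : ℕ} (x : Fin d → ℤ) (ξ : Fin d → ℝ) : ℝ := ∑ j : Fin d, (x j : ℝ) * ξ j

/-- The frequency torus `𝕋ᵈ = [-π, π]ᵈ`. -/
def torus (d : ℕ) : Set (Fin d → ℝ) := Set.univ.pi fun _ => Set.Icc (-Real.pi) Real.pi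

/-- The Fourier transform `û(ξ) = (2π)^{-d/2} ∑ₓ u(x) e^{-i⟨x,ξ⟩}` of `u ∈ ℓ¹(ℤᵈ)`. -/
def fourierZ {d : ℕ} (u : Ell d 1) (ξ : Fin d → ℝ) : ℂ :=
  (((2 * Real.pi) ^ (-(d : ℝ) / 2) : ℝ) : ℂ) *
    ∑' x : Fin d → ℤ, u x * Complex.exp (-(Complex.I * (pairing x ξ : ℂ)))

/-- The symbol `ω(ξ) = 4 ∑ⱼ sin²(ξⱼ / 2)` of the discrete Laplacian `-Δ`. -/
def symbol {d : ℕ} (ξ : Fin d → ℝ) : ℝ := 4 * ∑ j : Fin d, Real.sin (ξ j / 2) ^ 2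

/-- `v = (-Δ)^s f` in `ℓ¹(ℤᵈ)`, where the power `(-Δ)^s` of the discrete Laplacian is the Fourier
multiplier with symbol `ω^s`. For given `f` at most one `v` has this property, because the Fourier
transform is injective on `ℓ¹(ℤᵈ)`. -/
def IsFracLaplacian {d : ℕ} (s : ℝ) (f v : Ell d 1) : Prop :=
  ∀ ξ ∈ torus d, fourierZ v ξ = ((symbol ξ ^ s : ℝ) : ℂ) * fourierZ f ξ

/-- `u` is a (strong) solution in `ℓ¹(ℤᵈ)` of `∂ₜ u + (-Δ)^s u = 0` for `t > 0`, `u(0) = u₀`: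
it is continuous on `[0, ∞)` and differentiable on `(0, ∞)` with values in `ℓ¹(ℤᵈ)`.
The values of `u` at negative times play no role. -/
structure IsSolution {d : ℕ} (s : ℝ) (u₀ : Ell d 1) (u : ℝ → Ell d 1) : Prop where
  continuousOn : ContinuousOn u (Set.Ici 0)
  equation : ∀ t : ℝ, 0 < t → ∃ v : Ell d 1, IsFracLaplacian s (u t) v ∧ HasDerivAt u (-v) t
  initial : u 0 = u₀

/-- The lattice fractional heat kernel
`G_t^{(s)}(x) = (2π)^{-d} ∫_{[-π,π]^d} e^{-t ω(ξ)^s} e^{i⟨x,ξ⟩} dξ`. -/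
def heatKernel {d : ℕ} (s t : ℝ) (x : Fin d → ℤ) : ℂ :=
  (1 / (2 * (Real.pi : ℂ)) ^ d) *
    ∫ ξ in torus d,
      ((Real.exp (-(t * symbol ξ ^ s)) : ℝ) : ℂ) * Complex.exp (Complex.I * (pairing x ξ : ℂ))

/-- The discrete convolution `(f * g)(x) = ∑_y f(x - y) g(y)`. -/
def conv {d : ℕ} (f g : (Fin d → ℤ) → ℂ) : (Fin d → ℤ) → ℂ := fun x =>
  ∑' y : Fin d → ℤ, f (x - y) * g y

/-- The Euclidean length `|x|` of a lattice point. -/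
def euclid {d : ℕ} (x : Fin d → ℤ) : ℝ := Real.sqrt (∑ j : Fin d, (x j : ℝ) ^ 2)

/-- The mass `M = ∑ₓ u₀(x)`. -/
def mass {d : ℕ} (u₀ : (Fin d → ℤ) → ℂ) : ℂ := ∑' x : Fin d → ℤ, u₀ x

/-- The first moment `N₁(u₀) = ∑ₓ |x| |u₀(x)|` is finite. -/
def HasFiniteFirstMoment {d : ℕ} (u₀ : (Fin d → ℤ) → ℂ) : Prop :=
  Summable fun x : Fin d → ℤ => euclid x * ‖u₀ x‖

/-- The first moment `N₁(u₀) = ∑ₓ |x| |u₀(x)|`. -/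
def firstMoment {d : ℕ} (u₀ : (Fin d → ℤ) → ℂ) : ℝ :=
  ∑' x : Fin d → ℤ, euclid x * ‖u₀ x‖

end LatticeDiffusion

end

noncomputable section

namespace LatticeDiffusion

open MeasureTheory

variable {d : ℕ}

/-! Everything takes place in the algebra of bounded operators on `ℓ¹`. With `Q` the lazy walk, `-Δ
= 4d (1 - Q)` and `‖Q‖ ≤ 1`. As `0 < s ≤ 1`, the binomial coefficients `aₙ` of `1 - (1 - r)^s` are
nonnegative and summable, so `(-Δ)^s = (4d)^s (1 - ∑ aₙ Q^{n+1})` is bounded and generates a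
norm-continuous group. Uniqueness follows by running this group backwards, and Fourier inversion
identifies its kernel with `G_t`.

For the asymptotics, `u(t) - M G_t = ∑_y u₀(y) (S_y G_t - G_t)`, so it suffices to control unit
differences of `G_t` in `ℓ¹`. The kernel is even and nonincreasing in each `|xⱼ|`, because laziness
makes `Q` preserve this shape (`kernel_mem_unimodalCone`). The `ℓ¹` norm of the difference then
telescopes to twice the mass on the hyperplane `xⱼ = 0` (`norm_sub_shift`). That mass is an integral
of the multiplier along one frequency axis, of size `t^{-1/(2s)}`
(`exists_norm_kernel_sub_shift_le`).

The `ℓ^∞` bound comes from the `ℓ¹` bound at time `t/2` and the smoothing of the remaining half step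
(`heatOp_sub_eq`, `exists_norm_kernel_apply_le`). Interpolation gives every other `p`. -/

/-! ### Translations on `ℓ¹` -/

lemma summable_norm (f : Ell d 1) : Summable fun x => ‖f x‖ := by
  simpa using (lp.memℓp f).summable (by simp)

lemma norm_eq_tsum (f : Ell d 1) : ‖f‖ = ∑' x, ‖f x‖ := by
  simpa using lp.norm_eq_tsum_rpow (by simp) f

lemma memℓp_one {f : (Fin d → ℤ) → ℂ} (hf : Summable fun x => ‖f x‖) : Memℓp f 1 :=
  memℓp_gen (by simpa using hf)

/-- Translation by the lattice vector `y`. -/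
def shift (y : Fin d → ℤ) : Ell d 1 →L[ℂ] Ell d 1 :=
  LinearMap.mkContinuous
    { toFun := fun f => ⟨fun x => f (x - y), memℓp_one
        ((Equiv.subRight y).summable_iff.mpr (summable_norm f))⟩
      map_add' := fun f g => rfl
      map_smul' := fun c f => rfl } 1 (fun f => by
      rw [one_mul, norm_eq_tsum, norm_eq_tsum]
      exact ((Equiv.subRight y).tsum_eq (fun x => ‖f x‖)).le)

@[simp] lemma shift_apply (y : Fin d → ℤ) (f : Ell d 1) (x : Fin d → ℤ) :
    shift y f x = f (x - y) := rfl

lemma norm_shift_apply (y : Fin d → ℤ) (f : Ell d 1) : ‖shift y f‖ = ‖f‖ := by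
  rw [norm_eq_tsum, norm_eq_tsum]
  exact (Equiv.subRight y).tsum_eq (fun x => ‖f x‖)

lemma norm_shift_le (y : Fin d → ℤ) : ‖shift y‖ ≤ 1 :=
  ContinuousLinearMap.opNorm_le_bound _ zero_le_one fun f => by
    rw [norm_shift_apply, one_mul]

lemma shift_add (y z : Fin d → ℤ) : shift (y + z) = shift y * shift z := by
  ext f x
  simp only [shift_apply, mul_apply_eq_comp]
  rw [sub_add_eq_sub_sub]

lemma shift_zero : shift (0 : Fin d → ℤ) = 1 := by
  ext f x
  simp

lemma shift_commute (y z : Fin d → ℤ) : Commute (shift y) (shift z) := by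
  rw [Commute, SemiconjBy, ← shift_add, ← shift_add, add_comm]

/-! ### Characters and the Fourier transform -/

/-- The character `x ↦ e^{-i⟨x,ξ⟩}` of the lattice. -/
def latticeChar (ξ : Fin d → ℝ) (x : Fin d → ℤ) : ℂ :=
  Complex.exp (-(Complex.I * (pairing x ξ : ℂ)))

lemma pairing_add (x y : Fin d → ℤ) (ξ : Fin d → ℝ) :
    pairing (x + y) ξ = pairing x ξ + pairing y ξ := by
  simp [pairing, add_mul, Finset.sum_add_distrib]

lemma pairing_neg (x : Fin d → ℤ) (ξ : Fin d → ℝ) : pairing (-x) ξ = -pairing x ξ := by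
  simp [pairing]

lemma norm_latticeChar (ξ : Fin d → ℝ) (x : Fin d → ℤ) : ‖latticeChar ξ x‖ = 1 := by
  rw [latticeChar, Complex.norm_exp]
  simp

lemma latticeChar_add (ξ : Fin d → ℝ) (x y : Fin d → ℤ) :
    latticeChar ξ (x + y) = latticeChar ξ x * latticeChar ξ y := by
  rw [latticeChar, latticeChar, latticeChar, ← Complex.exp_add, pairing_add]
  congr 1
  push_cast
  ring

lemma summable_norm_mul_latticeChar (f : Ell d 1) (ξ : Fin d → ℝ) :
    Summable fun x => ‖f x * latticeChar ξ x‖ := by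
  simpa [norm_latticeChar] using summable_norm f

/-- The unnormalised Fourier transform `f ↦ ∑ₓ f(x) e^{-i⟨x,ξ⟩}` as a functional on `ℓ¹`. -/
def fourierCLM (ξ : Fin d → ℝ) : Ell d 1 →L[ℂ] ℂ :=
  LinearMap.mkContinuous
    { toFun := fun f => ∑' x, f x * latticeChar ξ x
      map_add' := fun f g => by
        rw [← (summable_norm_mul_latticeChar f ξ).of_norm.tsum_add
          (summable_norm_mul_latticeChar g ξ).of_norm]
        exact tsum_congr fun x => by simp [add_mul]
      map_smul' := fun c f => by
        simp only [lp.coeFn_smul, Pi.smul_apply, smul_eq_mul, mul_assoc, tsum_mul_left,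
          RingHom.id_apply] } 1 (fun f => by
      rw [one_mul, norm_eq_tsum]
      refine (norm_tsum_le_tsum_norm (summable_norm_mul_latticeChar f ξ)).trans_eq ?_
      simp [norm_latticeChar])

lemma fourierCLM_apply (ξ : Fin d → ℝ) (f : Ell d 1) :
    fourierCLM ξ f = ∑' x, f x * latticeChar ξ x := rfl

lemma fourierZ_eq (f : Ell d 1) (ξ : Fin d → ℝ) :
    fourierZ f ξ = (((2 * Real.pi) ^ (-(d : ℝ) / 2) : ℝ) : ℂ) * fourierCLM ξ f := rfl

lemma fourierCLM_shift (ξ : Fin d → ℝ) (y : Fin d → ℤ) (f : Ell d 1) :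
    fourierCLM ξ (shift y f) = latticeChar ξ y * fourierCLM ξ f := by
  rw [fourierCLM_apply, fourierCLM_apply, ← tsum_mul_left, ← (Equiv.addRight y).tsum_eq]
  refine tsum_congr fun x => ?_
  simp only [Equiv.coe_addRight, shift_apply, add_sub_cancel_right, latticeChar_add]
  ring

lemma fourierCLM_single_zero (ξ : Fin d → ℝ) : fourierCLM ξ (lp.single 1 0 1) = 1 := by
  rw [fourierCLM_apply, tsum_eq_single 0]
  · simp [latticeChar, pairing]
  · intro x hx
    simp [lp.single_apply, hx]

/-! ### The lazy random walk -/

/-- The lazy simple random walk operator `½ + (4d)⁻¹ ∑ⱼ (S_{eⱼ} + S_{-eⱼ}) = 1 - (4d)⁻¹ (-Δ)`. -/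
def walk (d : ℕ) : Ell d 1 →L[ℂ] Ell d 1 :=
  (1 / 2 : ℂ) • 1 +
    (1 / (4 * d) : ℂ) • ∑ j : Fin d, (shift (Pi.single j 1) + shift (-(Pi.single j 1)))

/-- The weights add up to one: `1/2` on the identity and `1/(4d)` on each of `2d` contractions. -/
lemma norm_walk_le (hd : 1 ≤ d) : ‖walk d‖ ≤ 1 := by
  have hd' : (0 : ℝ) < d := by exact_mod_cast hd
  have h1 : ‖(1 / 2 : ℂ) • (1 : Ell d 1 →L[ℂ] Ell d 1)‖ ≤ 1 / 2 := by
    refine (norm_smul_le (1 / 2 : ℂ) (1 : Ell d 1 →L[ℂ] Ell d 1)).trans ?_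
    have := ContinuousLinearMap.norm_id_le (𝕜 := ℂ) (E := Ell d 1)
    calc _ ≤ ‖(1 / 2 : ℂ)‖ * 1 := by gcongr; exact this
      _ = 1 / 2 := by norm_num
  have h2 : ‖∑ j : Fin d, (shift (Pi.single j 1) + shift (-(Pi.single j 1)))‖ ≤ 2 * d := by
    refine (norm_sum_le _ _).trans ?_
    have h (j : Fin d) : ‖shift (Pi.single j 1) + shift (-(Pi.single j 1))‖ ≤ 2 := by
      refine (norm_add_le _ _).trans ?_
      linarith [norm_shift_le (Pi.single j 1), norm_shift_le (-(Pi.single j 1))]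
    calc _ ≤ ∑ j : Fin d, (2 : ℝ) := Finset.sum_le_sum fun j _ => h j
      _ = 2 * d := by simp [mul_comm]
  refine (norm_add_le _ _).trans ?_
  have h3 : ‖(1 / (4 * d) : ℂ)‖ = 1 / (4 * d) := by simp
  have h4 := norm_smul_le (1 / (4 * d) : ℂ)
    (∑ j : Fin d, (shift (Pi.single j 1) + shift (-(Pi.single j 1))) : Ell d 1 →L[ℂ] Ell d 1)
  rw [h3] at h4
  have h5 : 1 / (4 * d : ℝ) * (2 * d) = 1 / 2 := by field_simp; norm_num
  have h6 : 1 / (4 * d : ℝ) * ‖∑ j : Fin d, (shift (Pi.single j 1) + shift (-(Pi.single j 1)))‖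
      ≤ 1 / (4 * d : ℝ) * (2 * d) := by gcongr
  linarith

lemma latticeChar_single_add (ξ : Fin d → ℝ) (j : Fin d) :
    latticeChar ξ (Pi.single j 1) + latticeChar ξ (-Pi.single j 1)
      = ((2 - 4 * Real.sin (ξ j / 2) ^ 2 : ℝ) : ℂ) := by
  have hp : pairing (Pi.single j 1) ξ = ξ j := by
    simp [pairing, Pi.single_apply]
  have hc : 2 - 4 * Real.sin (ξ j / 2) ^ 2 = 2 * Real.cos (ξ j) := by
    have := Real.cos_two_mul' (ξ j / 2)
    have h1 := Real.sin_sq_add_cos_sq (ξ j / 2)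
    rw [mul_div_cancel₀ _ two_ne_zero] at this
    nlinarith
  rw [hc, latticeChar, latticeChar, pairing_neg, hp]
  push_cast
  rw [Complex.two_cos]
  rw [add_comm]
  congr 2 <;> ring

lemma fourierCLM_walk (hd : 1 ≤ d) (ξ : Fin d → ℝ) (f : Ell d 1) :
    fourierCLM ξ (walk d f) = ((1 - symbol ξ / (4 * d) : ℝ) : ℂ) * fourierCLM ξ f := by
  have hd' : (d : ℂ) ≠ 0 := by exact_mod_cast (by omega : d ≠ 0)
  simp only [walk, add_apply, smul_apply, one_apply_eq_self, sum_apply, map_add, map_smul,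
    map_sum, fourierCLM_shift, ← add_mul, latticeChar_single_add, ← Finset.sum_mul, smul_eq_mul]
  rw [← Complex.ofReal_sum, Finset.sum_sub_distrib, ← Finset.mul_sum, symbol]
  simp only [Finset.sum_const, Finset.card_univ, Fintype.card_fin]
  push_cast
  field_simp
  ring

lemma commute_shift_walk (y : Fin d → ℤ) : Commute (shift y) (walk d) := by
  refine Commute.add_right ((Commute.one_right _).smul_right _) (Commute.smul_right ?_ _)
  exact Commute.sum_right _ _ _ fun j _ => (shift_commute _ _).add_right (shift_commute _ _)

/-! ### The binomial series of `(1 - r)^s` -/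

/-- The coefficients `aₙ` in `(1 - r)^s = 1 - ∑ₙ aₙ r^{n+1}`. -/
def powCoeff (s : ℝ) (n : ℕ) : ℝ := (-1) ^ n * Ring.choose s (n + 1)

lemma powCoeff_succ (s : ℝ) (n : ℕ) :
    powCoeff s (n + 1) = powCoeff s n * ((n + 1 - s) / (n + 2)) := by
  have h := Ring.descPochhammer_eq_factorial_smul_choose s (n + 2)
  have h' := Ring.descPochhammer_eq_factorial_smul_choose s (n + 1)
  rw [descPochhammer_succ_right, Polynomial.smeval_mul, h'] at h
  simp only [nsmul_eq_mul, Polynomial.smeval_sub, Polynomial.smeval_X, pow_one,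
    Polynomial.smeval_natCast, pow_zero, mul_one] at h
  have hf : ((n + 2).factorial : ℝ) = (n + 2) * (n + 1).factorial := by
    rw [Nat.factorial_succ]; push_cast; ring
  have hf0 : ((n + 1).factorial : ℝ) ≠ 0 := by positivity
  have hn : (n + 2 : ℝ) ≠ 0 := by positivity
  rw [hf] at h
  have h2 : (n + 2 : ℝ) * Ring.choose s (n + 2) = Ring.choose s (n + 1) * (s - (n + 1)) := by
    apply mul_left_cancel₀ hf0
    push_cast at h
    linear_combination -h
  rw [powCoeff, powCoeff, pow_succ, mul_div_assoc', eq_div_iff hn]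
  linear_combination (-(-1) ^ n) * h2

lemma powCoeff_nonneg {s : ℝ} (hs : s ∈ Set.Ioc (0 : ℝ) 1) (n : ℕ) : 0 ≤ powCoeff s n := by
  induction n with
  | zero => simpa [powCoeff] using hs.1.le
  | succ n ih =>
    rw [powCoeff_succ]
    have : (0 : ℝ) ≤ n + 1 - s := by linarith [hs.2, n.cast_nonneg (α := ℝ)]
    positivity

lemma hasSum_powCoeff_of_lt {s r : ℝ} (hr : |r| < 1) :
    HasSum (fun n => powCoeff s n * r ^ (n + 1)) (1 - (1 - r) ^ s) := by
  have h := (Real.one_add_rpow_hasFPowerSeriesOnBall_zero (a := s)).hasSum (y := -r)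
    (by simpa [enorm_eq_nnnorm, ← NNReal.coe_lt_coe] using hr)
  simp only [binomialSeries_apply, zero_add, List.ofFn_const, List.prod_replicate,
    smul_eq_mul] at h
  rw [← hasSum_nat_add_iff' 1] at h
  have h2 := h.neg
  simp only [Finset.sum_range_one, pow_zero, Ring.choose_zero_right, mul_one, neg_sub,
    ← sub_eq_add_neg] at h2
  convert! h2 using 1
  · ext n
    rw [powCoeff, neg_pow r, pow_succ]
    ring

/-- For `0 < r < 1`, positivity bounds each partial sum by `1 - (1 - r)^s ≤ 1`; let `r` increase to
`1`. -/
lemma summable_powCoeff {s : ℝ} (hs : s ∈ Set.Ioc (0 : ℝ) 1) : Summable (powCoeff s) := by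
  refine summable_of_sum_range_le (c := 1) (powCoeff_nonneg hs) fun N => ?_
  have hc : Continuous fun r : ℝ => ∑ n ∈ Finset.range N, powCoeff s n * r ^ (n + 1) := by
    fun_prop
  have h1 : Filter.Tendsto (fun r : ℝ => ∑ n ∈ Finset.range N, powCoeff s n * r ^ (n + 1))
      (nhdsWithin 1 (Set.Iio 1)) (nhds (∑ n ∈ Finset.range N, powCoeff s n)) := by
    have := hc.tendsto 1
    simp only [one_pow, mul_one] at this
    exact this.mono_left nhdsWithin_le_nhds
  refine le_of_tendsto h1 ?_
  filter_upwards [Ioo_mem_nhdsLT (zero_lt_one (α := ℝ))] with r hr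
  have hS := hasSum_powCoeff_of_lt (s := s) (r := r) (by rw [abs_of_pos hr.1]; exact hr.2)
  refine (sum_le_hasSum _ (fun n _ => mul_nonneg (powCoeff_nonneg hs n)
    (pow_nonneg hr.1.le _)) hS).trans ?_
  have : 0 ≤ (1 - r) ^ s := Real.rpow_nonneg (by linarith [hr.2]) _
  linarith

/-- The endpoint `r = 1` is needed at zeros of the symbol, such as `ξ = 0`. Both sides are
continuous up to it, the series by uniform convergence. -/
lemma hasSum_powCoeff {s r : ℝ} (hs : s ∈ Set.Ioc (0 : ℝ) 1) (hr : r ∈ Set.Icc (0 : ℝ) 1) :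
    HasSum (fun n => powCoeff s n * r ^ (n + 1)) (1 - (1 - r) ^ s) := by
  rcases hr.2.lt_or_eq with h | rfl
  · exact hasSum_powCoeff_of_lt (by rw [abs_of_nonneg hr.1]; exact h)
  have hbound : ∀ n, ∀ r ∈ Set.Icc (0 : ℝ) 1, ‖powCoeff s n * r ^ (n + 1)‖ ≤ powCoeff s n := by
    intro n r hr
    rw [Real.norm_of_nonneg (mul_nonneg (powCoeff_nonneg hs n) (pow_nonneg hr.1 _))]
    exact mul_le_of_le_one_right (powCoeff_nonneg hs n) (pow_le_one₀ hr.1 hr.2)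
  have hcont : ContinuousOn (fun r : ℝ => ∑' n, powCoeff s n * r ^ (n + 1)) (Set.Icc 0 1) :=
    continuousOn_tsum (fun n => by fun_prop) (summable_powCoeff hs) hbound
  have hcont2 : ContinuousOn (fun r : ℝ => 1 - (1 - r) ^ s) (Set.Icc 0 1) :=
    (continuous_const.sub ((continuous_const.sub continuous_id).rpow_const
      fun _ => Or.inr hs.1.le)).continuousOn
  have heq : Set.EqOn (fun r : ℝ => ∑' n, powCoeff s n * r ^ (n + 1))
      (fun r : ℝ => 1 - (1 - r) ^ s) (Set.Icc 0 1) := by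
    refine Set.EqOn.of_subset_closure (s := Set.Ico 0 1) ?_ hcont hcont2
      Set.Ico_subset_Icc_self (by rw [closure_Ico zero_ne_one])
    intro r hr
    exact (hasSum_powCoeff_of_lt (by rw [abs_of_nonneg hr.1]; exact hr.2)).tsum_eq
  have hsum : Summable fun n => powCoeff s n * (1 : ℝ) ^ (n + 1) := by
    simpa using summable_powCoeff hs
  have h1 := heq hr
  simp only at h1
  rw [← h1]
  exact hsum.hasSum

/-! ### The fractional Laplacian and its semigroup on `ℓ¹` -/

/-- The operator `∑ₙ aₙ Q^{n+1} = 1 - (1 - Q)^s`, where `Q` is the lazy random walk. -/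
def walkSeries (d : ℕ) (s : ℝ) : Ell d 1 →L[ℂ] Ell d 1 :=
  ∑' n : ℕ, (powCoeff s n : ℂ) • walk d ^ (n + 1)

/-- The fractional Laplacian `(-Δ)^s = (4d)^s (1 - Q)^s` as a bounded operator on `ℓ¹`. -/
def fracLap (d : ℕ) (s : ℝ) : Ell d 1 →L[ℂ] Ell d 1 :=
  (((4 * d : ℝ) ^ s : ℝ) : ℂ) • (1 - walkSeries d s)

/-- The semigroup `e^{-t(-Δ)^s}` on `ℓ¹`. -/
def heatOp (d : ℕ) (s t : ℝ) : Ell d 1 →L[ℂ] Ell d 1 :=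
  NormedSpace.exp (t • (-fracLap d s))

lemma hasSum_walkSeries (hd : 1 ≤ d) {s : ℝ} (hs : s ∈ Set.Ioc (0 : ℝ) 1) :
    HasSum (fun n : ℕ => (powCoeff s n : ℂ) • walk d ^ (n + 1)) (walkSeries d s) := by
  refine (Summable.of_norm_bounded (summable_powCoeff hs) fun n => ?_).hasSum
  refine (norm_smul_le (powCoeff s n : ℂ) (walk d ^ (n + 1))).trans ?_
  rw [Complex.norm_real, Real.norm_of_nonneg (powCoeff_nonneg hs n)]
  refine mul_le_of_le_one_right (powCoeff_nonneg hs n) ?_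
  exact (norm_pow_le' _ n.succ_pos).trans (pow_le_one₀ (norm_nonneg _) (norm_walk_le hd))

lemma symbol_nonneg (ξ : Fin d → ℝ) : 0 ≤ symbol ξ := by
  unfold symbol; positivity

lemma symbol_le (ξ : Fin d → ℝ) : symbol ξ ≤ 4 * d := by
  have : ∑ j : Fin d, Real.sin (ξ j / 2) ^ 2 ≤ ∑ j : Fin d, 1 :=
    Finset.sum_le_sum fun j _ => Real.sin_sq_le_one _
  simp only [Finset.sum_const, Finset.card_univ, Fintype.card_fin, nsmul_eq_mul, mul_one] at this
  unfold symbol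
  linarith

lemma fourierCLM_walk_pow (hd : 1 ≤ d) (ξ : Fin d → ℝ) (n : ℕ) (f : Ell d 1) :
    fourierCLM ξ ((walk d ^ n) f) = ((1 - symbol ξ / (4 * d) : ℝ) : ℂ) ^ n * fourierCLM ξ f := by
  induction n with
  | zero => simp
  | succ n ih =>
    rw [pow_succ', mul_apply_eq_comp, fourierCLM_walk hd, ih, pow_succ']
    ring

lemma fourierCLM_fracLap (hd : 1 ≤ d) {s : ℝ} (hs : s ∈ Set.Ioc (0 : ℝ) 1) (ξ : Fin d → ℝ)
    (f : Ell d 1) :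
    fourierCLM ξ (fracLap d s f) = ((symbol ξ ^ s : ℝ) : ℂ) * fourierCLM ξ f := by
  have hd' : (0 : ℝ) < 4 * d := by
    have : (0 : ℝ) < d := by exact_mod_cast hd
    positivity
  have hr : 1 - symbol ξ / (4 * d) ∈ Set.Icc (0 : ℝ) 1 :=
    ⟨sub_nonneg.mpr ((div_le_one hd').mpr (symbol_le ξ)),
      sub_le_self _ (div_nonneg (symbol_nonneg ξ) hd'.le)⟩
  have h1 := ((hasSum_walkSeries hd hs).mapL
    ((fourierCLM ξ).comp (ContinuousLinearMap.apply ℂ (Ell d 1) f) : _ →L[ℂ] ℂ))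
  simp only [ContinuousLinearMap.comp_apply, ContinuousLinearMap.apply_apply, map_smul,
    fourierCLM_walk_pow hd, smul_eq_mul] at h1
  have h2 := ((Complex.hasSum_ofReal.mpr (hasSum_powCoeff hs hr))).mul_right (fourierCLM ξ f)
  rw [sub_sub_cancel] at h2
  have h3 := h1.unique (by simpa [mul_assoc] using h2)
  rw [fracLap, smul_apply, map_smul, sub_apply, map_sub, h3, one_apply_eq_self]
  have h4 : symbol ξ ^ s = (4 * d) ^ s * (symbol ξ / (4 * d)) ^ s := by
    rw [← Real.mul_rpow hd'.le (div_nonneg (symbol_nonneg ξ) hd'.le), mul_div_cancel₀ _ hd'.ne']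
  rw [h4, smul_eq_mul]
  push_cast
  ring

/-- The functional `F` is an eigenvector of the transpose of `T`, so it can be applied to the
exponential series term by term. -/
lemma map_exp_of_eigen (F : Ell d 1 →L[ℂ] ℂ) (T : Ell d 1 →L[ℂ] Ell d 1) (c : ℂ)
    (h : ∀ f, F (T f) = c * F f) (f : Ell d 1) :
    F (NormedSpace.exp T f) = Complex.exp c * F f := by
  have hpow (n : ℕ) : F ((T ^ n) f) = c ^ n * F f := by
    induction n with
    | zero => simp
    | succ n ih => rw [pow_succ', mul_apply_eq_comp, h, ih, pow_succ']; ring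
  have h1 := (NormedSpace.exp_series_hasSum_exp' (𝕂 := ℂ) T).mapL
    (F.comp (ContinuousLinearMap.apply ℂ (Ell d 1) f) : _ →L[ℂ] ℂ)
  simp only [ContinuousLinearMap.comp_apply, ContinuousLinearMap.apply_apply, map_smul,
    hpow, smul_eq_mul] at h1
  have h2 := (NormedSpace.exp_series_hasSum_exp' (𝕂 := ℂ) c).mul_right (F f)
  rw [← Complex.exp_eq_exp_ℂ] at h2
  exact h1.unique (by simpa [mul_assoc] using h2)

lemma fourierCLM_heatOp (hd : 1 ≤ d) {s : ℝ} (hs : s ∈ Set.Ioc (0 : ℝ) 1) (t : ℝ) (ξ : Fin d → ℝ)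
    (f : Ell d 1) :
    fourierCLM ξ (heatOp d s t f)
      = ((Real.exp (-(t * symbol ξ ^ s)) : ℝ) : ℂ) * fourierCLM ξ f := by
  rw [heatOp, map_exp_of_eigen (fourierCLM ξ) _ (-(t * symbol ξ ^ s) : ℝ)]
  · push_cast; rfl
  · intro f
    have h (g : Ell d 1) : t • g = (t : ℂ) • g := by
      ext x
      exact Complex.real_smul
    rw [smul_apply, neg_apply, h, map_smul, map_neg, fourierCLM_fracLap hd hs,
      smul_eq_mul]
    push_cast
    ring

lemma isFracLaplacian_fracLap (hd : 1 ≤ d) {s : ℝ} (hs : s ∈ Set.Ioc (0 : ℝ) 1) (f : Ell d 1) :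
    IsFracLaplacian s f (fracLap d s f) := fun ξ _ => by
  rw [fourierZ_eq, fourierZ_eq, fourierCLM_fracLap hd hs]
  ring

lemma commute_shift_walkSeries (hd : 1 ≤ d) {s : ℝ} (hs : s ∈ Set.Ioc (0 : ℝ) 1)
    (y : Fin d → ℤ) : Commute (shift y) (walkSeries d s) := by
  have h := hasSum_walkSeries hd hs
  refine (h.mul_left (shift y)).unique ?_
  convert! h.mul_right (shift y) using 2 with n
  exact (((commute_shift_walk y).pow_right _).smul_right _).eq

lemma commute_shift_heatOp (hd : 1 ≤ d) {s : ℝ} (hs : s ∈ Set.Ioc (0 : ℝ) 1) (t : ℝ)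
    (y : Fin d → ℤ) : Commute (shift y) (heatOp d s t) := by
  have h : Commute (shift y) (fracLap d s) :=
    ((Commute.one_right _).sub_right (commute_shift_walkSeries hd hs y)).smul_right _
  exact (h.neg_right.smul_right t).exp_right

lemma real_smul_eq (t : ℝ) (T : Ell d 1 →L[ℂ] Ell d 1) : t • T = (t : ℂ) • T := by
  ext f x
  exact Complex.real_smul

lemma heatOp_zero (s : ℝ) : heatOp d s 0 = 1 := by
  simp [heatOp]

lemma heatOp_add (s t r : ℝ) : heatOp d s (t + r) = heatOp d s t * heatOp d s r := by
  let +nondep : NormedAlgebra ℚ (Ell d 1 →L[ℂ] Ell d 1) := .restrictScalars ℚ ℂ _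
  rw [heatOp, add_smul, NormedSpace.exp_add_of_commute]
  · rfl
  · exact ((Commute.refl _).smul_left _).smul_right _

lemma hasDerivAt_heatOp (s t : ℝ) :
    HasDerivAt (heatOp d s) (heatOp d s t * (-fracLap d s)) t :=
  hasDerivAt_exp_smul_const (-fracLap d s) t

lemma hasDerivAt_heatOp' (s t : ℝ) :
    HasDerivAt (heatOp d s) ((-fracLap d s) * heatOp d s t) t :=
  hasDerivAt_exp_smul_const' (-fracLap d s) t

/-! ### Fourier inversion on the torus -/

lemma integral_tsum_mul {α : Type*} [MeasurableSpace α] {μ : Measure α} [IsFiniteMeasure μ]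
    (f : Ell d 1) (g : (Fin d → ℤ) → α → ℂ) (hg : ∀ y, AEStronglyMeasurable (g y) μ)
    (hg1 : ∀ y a, ‖g y a‖ ≤ 1) :
    ∫ a, ∑' y, f y * g y a ∂μ = ∑' y, f y * ∫ a, g y a ∂μ := by
  have hint (y : Fin d → ℤ) : Integrable (g y) μ :=
    Integrable.of_bound (hg y) 1 (Filter.Eventually.of_forall (hg1 y))
  have h := hasSum_integral_of_summable_integral_norm (μ := μ) (F := fun y a => f y * g y a)
    (fun y => (hint y).const_mul (f y)) (by
      refine Summable.of_nonneg_of_le (fun y => integral_nonneg fun a => norm_nonneg _)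
        (fun y => ?_) ((summable_norm f).mul_right (μ.real Set.univ))
      calc ∫ a, ‖f y * g y a‖ ∂μ ≤ ∫ a, ‖f y‖ ∂μ := by
            refine integral_mono ((hint y).const_mul (f y)).norm (integrable_const _) fun a => ?_
            simp only [norm_mul]
            exact mul_le_of_le_one_right (norm_nonneg _) (hg1 y a)
        _ = ‖f y‖ * μ.real Set.univ := by simp [mul_comm])
  rw [← h.tsum_eq]
  exact tsum_congr fun y => integral_const_mul _ _

lemma integral_exp_int (n : ℤ) :
    ∫ η in Set.Icc (-Real.pi) Real.pi, Complex.exp (Complex.I * (n * η))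
      = if n = 0 then (2 * Real.pi : ℂ) else 0 := by
  rw [integral_Icc_eq_integral_Ioc,
    ← intervalIntegral.integral_of_le (by linarith [Real.pi_pos])]
  split_ifs with hn
  · subst hn
    simp
    ring
  · have hc : Complex.I * n ≠ 0 := mul_ne_zero Complex.I_ne_zero (by exact_mod_cast hn)
    have h := integral_exp_mul_complex (a := -Real.pi) (b := Real.pi) hc
    simp only [mul_assoc] at h
    rw [h, div_eq_zero_iff, sub_eq_zero]
    left
    rw [Complex.exp_eq_exp_iff_exists_int]
    exact ⟨n, by push_cast; ring⟩

instance isFiniteMeasure_torus : IsFiniteMeasure (volume.restrict (torus d)) :=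
  ⟨by
    rw [Measure.restrict_apply_univ]
    exact (isCompact_univ_pi fun _ => isCompact_Icc).measure_lt_top⟩

lemma volume_restrict_torus : (volume : Measure (Fin d → ℝ)).restrict (torus d)
    = Measure.pi fun _ => volume.restrict (Set.Icc (-Real.pi) Real.pi) := by
  rw [torus, volume_pi, Measure.restrict_pi_pi]

@[fun_prop]
lemma continuous_pairing (x : Fin d → ℤ) : Continuous (pairing x) := by
  unfold pairing; fun_prop

lemma integral_torus_exp (x : Fin d → ℤ) :
    ∫ ξ in torus d, Complex.exp (Complex.I * (pairing x ξ : ℂ))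
      = if x = 0 then (2 * Real.pi : ℂ) ^ d else 0 := by
  have h (ξ : Fin d → ℝ) : Complex.exp (Complex.I * (pairing x ξ : ℂ))
      = ∏ j, Complex.exp (Complex.I * (x j * ξ j)) := by
    rw [← Complex.exp_sum, pairing]
    push_cast
    rw [Finset.mul_sum]
  simp only [h]
  rw [volume_restrict_torus, integral_fintype_prod_eq_prod
    (f := fun j (η : ℝ) => Complex.exp (Complex.I * (x j * η)))]
  simp only [integral_exp_int]
  split_ifs with hx
  · simp [hx]
  · obtain ⟨j, hj⟩ := Function.ne_iff.mp hx
    exact Finset.prod_eq_zero (Finset.mem_univ j) (if_neg hj)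

lemma fourierCLM_inversion (f : Ell d 1) (x : Fin d → ℤ) :
    (1 / (2 * (Real.pi : ℂ)) ^ d) *
      ∫ ξ in torus d, fourierCLM ξ f * Complex.exp (Complex.I * (pairing x ξ : ℂ)) = f x := by
  have hmul (ξ : Fin d → ℝ) : fourierCLM ξ f * Complex.exp (Complex.I * (pairing x ξ : ℂ))
      = ∑' y, f y * Complex.exp (Complex.I * (pairing (x - y) ξ : ℂ)) := by
    rw [fourierCLM_apply, ← tsum_mul_right]
    refine tsum_congr fun y => ?_
    rw [mul_assoc, latticeChar, ← Complex.exp_add, sub_eq_add_neg, pairing_add, pairing_neg]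
    push_cast
    ring_nf
  simp only [hmul]
  rw [integral_tsum_mul]
  · simp only [integral_torus_exp, sub_eq_zero]
    rw [tsum_eq_single x (fun y hy => by simp [hy.symm])]
    have : (2 * (Real.pi : ℂ)) ^ d ≠ 0 :=
      pow_ne_zero _ (mul_ne_zero two_ne_zero (by exact_mod_cast Real.pi_ne_zero))
    rw [if_pos rfl]
    field_simp
  · intro y
    exact Continuous.aestronglyMeasurable (by fun_prop)
  · intro y ξ
    rw [Complex.norm_exp]
    simp

/-- Immediate from inversion; it makes the relation `IsFracLaplacian` single-valued, hence given by
the operator `fracLap`. -/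
lemma eq_of_fourierCLM_eq {f g : Ell d 1} (h : ∀ ξ ∈ torus d, fourierCLM ξ f = fourierCLM ξ g) :
    f = g := by
  ext x
  rw [← fourierCLM_inversion f x, ← fourierCLM_inversion g x]
  congr 1
  refine setIntegral_congr_fun (MeasurableSet.univ_pi fun _ => measurableSet_Icc) fun ξ hξ => ?_
  simp only [h ξ hξ]

lemma IsFracLaplacian.eq_fracLap (hd : 1 ≤ d) {s : ℝ} (hs : s ∈ Set.Ioc (0 : ℝ) 1)
    {f v : Ell d 1} (h : IsFracLaplacian s f v) : v = fracLap d s f := by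
  refine eq_of_fourierCLM_eq fun ξ hξ => ?_
  have h1 := (h ξ hξ).trans (isFracLaplacian_fracLap hd hs f ξ hξ).symm
  rw [fourierZ_eq, fourierZ_eq] at h1
  refine mul_left_cancel₀ ?_ h1
  exact_mod_cast (Real.rpow_pos_of_pos (by positivity) _).ne'

/-! ### The heat kernel and well-posedness -/

/-- The fundamental solution `e^{-t(-Δ)^s} δ₀`. -/
def kernel (d : ℕ) (s t : ℝ) : Ell d 1 := heatOp d s t (lp.single 1 0 1)

lemma kernel_apply (hd : 1 ≤ d) {s : ℝ} (hs : s ∈ Set.Ioc (0 : ℝ) 1) (t : ℝ) (x : Fin d → ℤ) :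
    kernel d s t x = heatKernel s t x := by
  rw [← fourierCLM_inversion, heatKernel]
  simp only [kernel, fourierCLM_heatOp hd hs, fourierCLM_single_zero, mul_one]

/-- Expand `f` in point masses, each a translate of the one at the origin, and use that the
semigroup commutes with translations. -/
lemma hasSum_heatOp (hd : 1 ≤ d) {s : ℝ} (hs : s ∈ Set.Ioc (0 : ℝ) 1) (t : ℝ) (f : Ell d 1) :
    HasSum (fun y => f y • shift y (kernel d s t)) (heatOp d s t f) := by
  have h := (lp.hasSum_single (by simp) f).mapL (heatOp d s t)
  convert! h using 2 with y
  have h1 : lp.single 1 y (f y) = f y • shift y (lp.single 1 0 1 : Ell d 1) := by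
    ext x
    simp [lp.single_apply, Pi.single_apply, sub_eq_zero]
  rw [h1, map_smul, kernel, ← mul_apply_eq_comp, ← mul_apply_eq_comp,
    (commute_shift_heatOp hd hs t y).eq]

lemma heatOp_apply (hd : 1 ≤ d) {s : ℝ} (hs : s ∈ Set.Ioc (0 : ℝ) 1) (t : ℝ) (f : Ell d 1)
    (x : Fin d → ℤ) : heatOp d s t f x = conv (heatKernel s t) f x := by
  have h := (hasSum_heatOp hd hs t f).mapL (lp.evalCLM ℂ (fun _ : Fin d → ℤ => ℂ) (p := 1) x)
  rw [conv]
  refine (h.tsum_eq.symm.trans (tsum_congr fun y => ?_))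
  change f y * kernel d s t (x - y) = _
  rw [kernel_apply hd hs, mul_comm]

lemma isSolution_heatOp (hd : 1 ≤ d) {s : ℝ} (hs : s ∈ Set.Ioc (0 : ℝ) 1) (u₀ : Ell d 1) :
    IsSolution s u₀ fun t => heatOp d s t u₀ := by
  have hder (t : ℝ) : HasDerivAt (fun t => heatOp d s t u₀) (-(fracLap d s (heatOp d s t u₀))) t :=
    (((ContinuousLinearMap.apply ℂ (Ell d 1) u₀).restrictScalars ℝ).hasFDerivAt.comp_hasDerivAt t
      (hasDerivAt_heatOp' s t))
  exact ⟨fun t _ => (hder t).continuousAt.continuousWithinAt,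
    fun t _ => ⟨_, isFracLaplacian_fracLap hd hs _, hder t⟩, by simp [heatOp_zero]⟩

/-- The generator is bounded, so the semigroup extends to negative times and `e^{r(-Δ)^s} u(r)`
makes sense; its derivative vanishes. -/
lemma IsSolution.eq_heatOp (hd : 1 ≤ d) {s : ℝ} (hs : s ∈ Set.Ioc (0 : ℝ) 1) {u₀ : Ell d 1}
    {u : ℝ → Ell d 1} (hu : IsSolution s u₀ u) {t : ℝ} (ht : 0 ≤ t) : u t = heatOp d s t u₀ := by
  set w : ℝ → Ell d 1 := fun r => heatOp d s (-r) (u r) with hw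
  have hder (r : ℝ) (hr : 0 < r) : HasDerivAt w 0 r := by
    obtain ⟨v, hv, hur⟩ := hu.equation r hr
    rw [hv.eq_fracLap hd hs] at hur
    have h1 : HasDerivAt (fun r => heatOp d s (-r)) (-(heatOp d s (-r) * (-fracLap d s))) r := by
      rw [← neg_one_smul ℝ]
      exact (hasDerivAt_heatOp s (-r)).scomp r (hasDerivAt_neg r)
    have h2 := ((ContinuousLinearMap.restrictScalarsL ℂ (Ell d 1) (Ell d 1) ℝ
      ℝ).hasFDerivAt.comp_hasDerivAt r h1).clm_apply hur
    convert! h2 using 1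
    simp
  have hcont : ContinuousOn w (Set.Ici 0) :=
    ((continuous_iff_continuousAt.mpr fun r =>
      (hasDerivAt_heatOp (d := d) s r).continuousAt).comp continuous_neg).continuousOn.clm_apply
      hu.continuousOn
  have hconst : w t = w 0 := by
    -- The equation holds only for positive times; continuity then carries constancy to time `0`.
    have hIoi : Set.EqOn w (fun _ => w 1) (Set.Ioi 0) := fun r hr =>
      isOpen_Ioi.is_const_of_deriv_eq_zero isPreconnected_Ioi
        (fun a ha => (hder a ha).differentiableAt.differentiableWithinAt)
        (fun a ha => (hder a ha).deriv) hr (Set.mem_Ioi.mpr one_pos)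
    have hIci := hIoi.of_subset_closure hcont continuousOn_const Set.Ioi_subset_Ici_self
      (by rw [closure_Ioi])
    rw [hIci ht, hIci (Set.self_mem_Ici (a := (0 : ℝ)))]
  have h1 : w 0 = u₀ := by simp [hw, heatOp_zero, hu.initial]
  rw [← h1, ← hconst, hw, ← mul_apply_eq_comp, ← heatOp_add]
  simp [heatOp_zero]

/-! ### Unimodality of the kernel in each coordinate -/

/-- Reflection of the lattice in the `j`-th coordinate. -/
def reflect (j : Fin d) (x : Fin d → ℤ) : Fin d → ℤ := Function.update x j (-x j)

lemma reflect_add_single_self (j : Fin d) (x : Fin d → ℤ) :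
    reflect j x + Pi.single j 1 = reflect j (x - Pi.single j 1) := by
  ext k
  by_cases h : k = j
  · subst h; simp [reflect]; ring
  · simp [reflect, h]

lemma reflect_sub_single_self (j : Fin d) (x : Fin d → ℤ) :
    reflect j x - Pi.single j 1 = reflect j (x + Pi.single j 1) := by
  ext k
  by_cases h : k = j
  · subst h; simp [reflect]; ring
  · simp [reflect, h]

lemma reflect_add_single_of_ne {j k : Fin d} (hjk : k ≠ j) (x : Fin d → ℤ) :
    reflect j x + Pi.single k 1 = reflect j (x + Pi.single k 1) := by
  ext i
  by_cases h : i = j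
  · subst h; simp [reflect, hjk.symm]
  · simp [reflect, h]

lemma reflect_sub_single_of_ne {j k : Fin d} (hjk : k ≠ j) (x : Fin d → ℤ) :
    reflect j x - Pi.single k 1 = reflect j (x - Pi.single k 1) := by
  ext i
  by_cases h : i = j
  · subst h; simp [reflect, hjk.symm]
  · simp [reflect, h]

/-- The cone of real sequences that are even in the `j`-th coordinate `xⱼ` and nonincreasing in
`|xⱼ|`. -/
def unimodalCone (j : Fin d) : AddSubmonoid (Ell d 1) where
  carrier := {f | ∀ x, (f x).im = 0 ∧ f (reflect j x) = f x ∧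
    (0 ≤ x j → (f (x + Pi.single j 1)).re ≤ (f x).re)}
  zero_mem' := by simp
  add_mem' {f g} hf hg x := by
    refine ⟨?_, ?_, fun hx => ?_⟩
    · simp [(hf x).1, (hg x).1]
    · simp [(hf x).2.1, (hg x).2.1]
    · simpa using add_le_add ((hf x).2.2 hx) ((hg x).2.2 hx)

lemma mem_unimodalCone {j : Fin d} {f : Ell d 1} : f ∈ unimodalCone j ↔
    ∀ x, (f x).im = 0 ∧ f (reflect j x) = f x ∧
      (0 ≤ x j → (f (x + Pi.single j 1)).re ≤ (f x).re) := Iff.rfl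

lemma smul_mem_unimodalCone {j : Fin d} {f : Ell d 1} (hf : f ∈ unimodalCone j) {c : ℝ}
    (hc : 0 ≤ c) : (c : ℂ) • f ∈ unimodalCone j := by
  intro x
  have h (y : Fin d → ℤ) : ((c : ℂ) • f) y = c * f y := rfl
  simp only [h, Complex.im_ofReal_mul, Complex.re_ofReal_mul, (hf x).1, (hf x).2.1, mul_zero,
    true_and]
  exact fun hx => mul_le_mul_of_nonneg_left ((hf x).2.2 hx) hc

lemma isClosed_unimodalCone (j : Fin d) : IsClosed (unimodalCone j : Set (Ell d 1)) := by
  have hev (x : Fin d → ℤ) : Continuous fun f : Ell d 1 => f x :=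
    (lp.evalCLM ℂ (fun _ : Fin d → ℤ => ℂ) (p := 1) x).continuous
  have : (unimodalCone j : Set (Ell d 1)) = ⋂ x, {f | (f x).im = 0 ∧ f (reflect j x) = f x ∧
    (0 ≤ x j → (f (x + Pi.single j 1)).re ≤ (f x).re)} := by
    ext f
    simp [mem_unimodalCone]
  rw [this]
  refine isClosed_iInter fun x => ?_
  refine (isClosed_eq (Complex.continuous_im.comp (hev x)) continuous_const).inter
    ((isClosed_eq (hev _) (hev _)).inter ?_)
  by_cases hx : 0 ≤ x j
  · simp only [hx, true_imp_iff]
    exact isClosed_le (Complex.continuous_re.comp (hev _)) (Complex.continuous_re.comp (hev _))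
  · simp only [hx, false_imp_iff]
    exact isClosed_univ

lemma hasSum_mem_unimodalCone {j : Fin d} {F : ℕ → Ell d 1} {f : Ell d 1}
    (hF : ∀ n, F n ∈ unimodalCone j) (h : HasSum F f) : f ∈ unimodalCone j :=
  (isClosed_unimodalCone j).mem_of_tendsto h
    (Filter.Eventually.of_forall fun _ => sum_mem fun n _ => hF n)

lemma single_mem_unimodalCone (j : Fin d) : lp.single 1 0 1 ∈ unimodalCone j := by
  intro x
  have h : reflect j x = 0 ↔ x = 0 := by
    constructor
    · intro h
      ext k
      have := congrFun h k
      by_cases hk : k = j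
      · subst hk; simpa [reflect] using this
      · simpa [reflect, hk] using this
    · rintro rfl
      ext k
      by_cases hk : k = j
      · subst hk; simp [reflect]
      · simp [reflect, hk]
  refine ⟨?_, ?_, fun hx => ?_⟩
  · rw [lp.single_apply, Pi.single_apply]
    split_ifs <;> simp
  · simp only [lp.single_apply, Pi.single_apply, h]
  · have hne : x + Pi.single j 1 ≠ 0 := by
      intro h
      have := congrFun h j
      simp at this
      omega
    simp only [lp.single_apply, Pi.single_apply, if_neg hne]
    split_ifs <;> simp

lemma add_shift_mem_unimodalCone {j k : Fin d} (hjk : k ≠ j) {f : Ell d 1}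
    (hf : f ∈ unimodalCone j) :
    shift (Pi.single k 1) f + shift (-(Pi.single k 1)) f ∈ unimodalCone j := by
  refine add_mem (fun x => ?_) (fun x => ?_)
  · simp only [shift_apply]
    refine ⟨(hf _).1, ?_, fun hx => ?_⟩
    · rw [reflect_sub_single_of_ne hjk, (hf _).2.1]
    · rw [add_sub_right_comm]
      exact (hf _).2.2 (by simpa [hjk.symm] using hx)
  · simp only [shift_apply, sub_neg_eq_add]
    refine ⟨(hf _).1, ?_, fun hx => ?_⟩
    · rw [reflect_add_single_of_ne hjk, (hf _).2.1]
    · rw [add_right_comm]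
      exact (hf _).2.2 (by simpa [hjk.symm] using hx)

/-- The lazy walk in one coordinate preserves unimodality; laziness is needed at the origin. -/
lemma smul_add_shift_mem_unimodalCone {j : Fin d} {f : Ell d 1} (hf : f ∈ unimodalCone j) {c : ℝ}
    (hc : 1 ≤ c) :
    (c : ℂ) • f + (shift (Pi.single j 1) f + shift (-(Pi.single j 1)) f) ∈ unimodalCone j := by
  intro x
  simp only [lp.coeFn_add, lp.coeFn_smul, Pi.add_apply, Pi.smul_apply, shift_apply, sub_neg_eq_add,
    smul_eq_mul]
  refine ⟨?_, ?_, fun hx => ?_⟩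
  · simp [(hf _).1]
  · rw [reflect_sub_single_self, reflect_add_single_self, (hf x).2.1, (hf _).2.1, (hf _).2.1,
      add_comm (f (x + _))]
  · simp only [Complex.add_re, Complex.re_ofReal_mul, add_sub_cancel_right]
    have h1 := (hf x).2.2 hx
    have h2 := (hf (x + Pi.single j 1)).2.2 (by simp; omega)
    -- At `xⱼ = 0` both neighbours of `x` carry the same value, and the claim becomes `(c - 1)(f(x)
    -- - f(x+eⱼ)) + (f(x+eⱼ) - f(x+2eⱼ)) ≥ 0`, which is where `1 ≤ c` enters.
    rcases hx.eq_or_lt with h0 | h0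
    · have h3 : f (x - Pi.single j 1) = f (x + Pi.single j 1) := by
        have hr : reflect j x = x := by
          rw [reflect, ← h0, neg_zero, h0, Function.update_eq_self]
        rw [← (hf (x + Pi.single j 1)).2.1, ← reflect_sub_single_self, hr]
      rw [h3]
      nlinarith
    · have h3 := (hf (x - Pi.single j 1)).2.2 (by simp; omega)
      rw [sub_add_cancel] at h3
      nlinarith

/-- After extracting `1/(4d)`, the identity has weight `2d ≥ 1`; all of it is assigned to the steps
in direction `j`. Steps in other directions preserve the cone by themselves. -/
lemma walk_mem_unimodalCone (hd : 1 ≤ d) {j : Fin d} {f : Ell d 1} (hf : f ∈ unimodalCone j) :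
    walk d f ∈ unimodalCone j := by
  have hd' : (0 : ℝ) < d := by exact_mod_cast hd
  have hdC : (d : ℂ) ≠ 0 := by exact_mod_cast (by omega : d ≠ 0)
  have h1 : walk d f = ((1 / (4 * d) : ℝ) : ℂ) •
      ((((2 * d : ℝ) : ℂ) • f + (shift (Pi.single j 1) f + shift (-(Pi.single j 1)) f)) +
        ∑ k ∈ Finset.univ.erase j, (shift (Pi.single k 1) f + shift (-(Pi.single k 1)) f)) := by
    rw [add_assoc, Finset.add_sum_erase _
      (fun k => shift (Pi.single k 1) f + shift (-(Pi.single k 1)) f) (Finset.mem_univ j),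
      smul_add, smul_smul]
    simp only [walk, add_apply, smul_apply, sum_apply, one_apply_eq_self]
    push_cast
    congr 2
    field_simp
    norm_num
  rw [h1]
  refine smul_mem_unimodalCone (add_mem (smul_add_shift_mem_unimodalCone hf ?_)
    (sum_mem fun k hk => add_shift_mem_unimodalCone (Finset.ne_of_mem_erase hk) hf)) (by positivity)
  have : (1 : ℝ) ≤ d := by exact_mod_cast hd
  linarith

lemma pow_mem_unimodalCone {j : Fin d} {T : Ell d 1 →L[ℂ] Ell d 1}
    (hT : ∀ f ∈ unimodalCone j, T f ∈ unimodalCone j) (n : ℕ) {f : Ell d 1}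
    (hf : f ∈ unimodalCone j) : (T ^ n) f ∈ unimodalCone j := by
  induction n with
  | zero => simpa using hf
  | succ n ih => rw [pow_succ', mul_apply_eq_comp]; exact hT _ ih

lemma exp_mem_unimodalCone {j : Fin d} {T : Ell d 1 →L[ℂ] Ell d 1}
    (hT : ∀ f ∈ unimodalCone j, T f ∈ unimodalCone j) {f : Ell d 1} (hf : f ∈ unimodalCone j) :
    NormedSpace.exp T f ∈ unimodalCone j := by
  refine hasSum_mem_unimodalCone (fun n => ?_) ((NormedSpace.exp_series_hasSum_exp' (𝕂 := ℂ) T).mapL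
    (ContinuousLinearMap.apply ℂ (Ell d 1) f))
  have := smul_mem_unimodalCone (pow_mem_unimodalCone hT n hf)
    (c := ((n.factorial : ℝ)⁻¹)) (by positivity)
  simpa using this

lemma walkSeries_mem_unimodalCone (hd : 1 ≤ d) {s : ℝ} (hs : s ∈ Set.Ioc (0 : ℝ) 1) {j : Fin d}
    {f : Ell d 1} (hf : f ∈ unimodalCone j) : walkSeries d s f ∈ unimodalCone j :=
  hasSum_mem_unimodalCone (fun n => smul_mem_unimodalCone
    (pow_mem_unimodalCone (fun _ => walk_mem_unimodalCone hd) (n + 1) hf) (powCoeff_nonneg hs n))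
    ((hasSum_walkSeries hd hs).mapL (ContinuousLinearMap.apply ℂ (Ell d 1) f))

/-- Splitting off the scalar part of the generator leaves, for `t ≥ 0`, the exponential of a
nonnegative multiple of `walkSeries`, whose series stays in the cone. -/
lemma heatOp_eq_smul_exp (s t : ℝ) : heatOp d s t =
    ((Real.exp (-(t * (4 * d) ^ s)) : ℝ) : ℂ) •
      NormedSpace.exp (((t * (4 * d) ^ s : ℝ) : ℂ) • walkSeries d s) := by
  let +nondep : NormedAlgebra ℚ (Ell d 1 →L[ℂ] Ell d 1) := .restrictScalars ℚ ℂ _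
  have h : t • (-fracLap d s) = algebraMap ℂ (Ell d 1 →L[ℂ] Ell d 1) ((-(t * (4 * d) ^ s) : ℝ) : ℂ)
      + ((t * (4 * d) ^ s : ℝ) : ℂ) • walkSeries d s := by
    rw [Algebra.algebraMap_eq_smul_one, real_smul_eq, fracLap]
    push_cast
    module
  rw [heatOp, h, NormedSpace.exp_add_of_commute (Algebra.commutes _ _),
    ← NormedSpace.algebraMap_exp_comm, ← Complex.exp_eq_exp_ℂ, ← Algebra.smul_def, Complex.ofReal_exp]

lemma kernel_mem_unimodalCone (hd : 1 ≤ d) {s : ℝ} (hs : s ∈ Set.Ioc (0 : ℝ) 1) {t : ℝ}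
    (ht : 0 ≤ t) (j : Fin d) : kernel d s t ∈ unimodalCone j := by
  rw [kernel, heatOp_eq_smul_exp, smul_apply]
  exact smul_mem_unimodalCone (exp_mem_unimodalCone (fun f hf => smul_mem_unimodalCone
    (walkSeries_mem_unimodalCone hd hs hf) (by positivity)) (single_mem_unimodalCone j))
    (Real.exp_nonneg _)

/-! ### Unit differences of unimodal sequences in `ℓ¹` -/

lemma norm_sub_shift_apply {j : Fin d} {f : Ell d 1} (hf : f ∈ unimodalCone j) (x : Fin d → ℤ) :
    ‖f x - f (x - Pi.single j 1)‖ =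
      (if 1 ≤ x j then 1 else -1) * ((f (x - Pi.single j 1)).re - (f x).re) := by
  have hre : ‖f x - f (x - Pi.single j 1)‖ = |(f x).re - (f (x - Pi.single j 1)).re| := by
    rw [← Complex.sub_re]
    exact (Complex.abs_re_eq_norm.mpr (by simp [(hf _).1])).symm
  rw [hre]
  split_ifs with h
  · have h1 := (hf (x - Pi.single j 1)).2.2 (by simpa using h)
    rw [sub_add_cancel] at h1
    rw [abs_of_nonpos (by linarith)]
    ring
  · have h1 := (hf (reflect j x)).2.2 (by simp [reflect]; omega)
    rw [reflect_add_single_self, (hf x).2.1, (hf _).2.1] at h1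
    rw [abs_of_nonneg (by linarith)]
    ring

/-- Summation by parts: the sign `σ` of the difference depends on `xⱼ` alone, and `σ(x + eⱼ) - σ(x)`
vanishes unless `xⱼ = 0`, where it equals `2`. -/
lemma norm_sub_shift {j : Fin d} {f : Ell d 1} (hf : f ∈ unimodalCone j) :
    ‖f - shift (Pi.single j 1) f‖ = 2 * ∑' x : Fin d → ℤ, (f x).re * if x j = 0 then 1 else 0 := by
  set σ : (Fin d → ℤ) → ℝ := fun x => if 1 ≤ x j then 1 else -1 with hσ
  have hσ1 (x : Fin d → ℤ) : |σ x| = 1 := by simp only [hσ]; split_ifs <;> simp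
  have hsum (y : Fin d → ℤ) : Summable fun x => σ (x + y) * (f x).re :=
    Summable.of_norm_bounded (summable_norm f) fun x => by
      rw [norm_mul, Real.norm_eq_abs, hσ1, one_mul, Real.norm_eq_abs]
      exact Complex.abs_re_le_norm _
  have hsum1 : Summable fun x => σ x * (f (x - Pi.single j 1)).re := by
    refine ((Equiv.subRight (Pi.single j 1)).summable_iff.mpr (hsum (Pi.single j 1))).congr
      fun x => ?_
    simp
  rw [norm_eq_tsum]
  calc ∑' x, ‖f x - f (x - Pi.single j 1)‖
      = ∑' x, (σ x * (f (x - Pi.single j 1)).re - σ x * (f x).re) :=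
        tsum_congr fun x => by rw [norm_sub_shift_apply hf, mul_sub]
    _ = ∑' x, σ x * (f (x - Pi.single j 1)).re - ∑' x, σ x * (f x).re :=
        hsum1.tsum_sub (by simpa using hsum 0)
    _ = ∑' x, σ (x + Pi.single j 1) * (f x).re - ∑' x, σ x * (f x).re := by
        congr 1
        rw [← (Equiv.addRight (Pi.single j 1)).tsum_eq]
        simp
    _ = ∑' x, (σ (x + Pi.single j 1) * (f x).re - σ x * (f x).re) :=
        ((hsum _).tsum_sub (by simpa using hsum 0)).symm
    _ = ∑' x, 2 * ((f x).re * if x j = 0 then 1 else 0) := by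
        refine tsum_congr fun x => ?_
        rw [← sub_mul]
        have : σ (x + Pi.single j 1) - σ x = 2 * if x j = 0 then 1 else 0 := by
          simp only [hσ, Pi.add_apply, Pi.single_eq_same]
          split_ifs <;> first | omega | norm_num
        rw [this]
        ring
    _ = _ := tsum_mul_left

/-- Integrating the characters along the `j`-th frequency axis annihilates every `x` with `xⱼ ≠ 0`.
-/
lemma slice_eq_integral (j : Fin d) (f : Ell d 1) :
    ∑' x : Fin d → ℤ, f x * (if x j = 0 then (2 * Real.pi : ℂ) else 0)
      = ∫ η in Set.Icc (-Real.pi) Real.pi, fourierCLM (Pi.single j η) f := by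
  have hp (x : Fin d → ℤ) (η : ℝ) :
      latticeChar (Pi.single j η) x = Complex.exp (Complex.I * ((-x j : ℤ) * η)) := by
    rw [latticeChar, pairing, Finset.sum_eq_single j]
    · rw [Pi.single_eq_same]; push_cast; ring_nf
    · intro k _ hk; simp [hk]
    · simp
  simp only [fourierCLM_apply]
  rw [integral_tsum_mul (g := fun x η => latticeChar (Pi.single j η) x)]
  · refine tsum_congr fun x => ?_
    simp only [hp, integral_exp_int, neg_eq_zero]
  · intro x
    simp only [hp]
    exact Continuous.aestronglyMeasurable (by fun_prop)
  · intro x η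
    exact (norm_latticeChar _ _).le

lemma norm_sub_shift_le {j : Fin d} {f : Ell d 1} (hf : f ∈ unimodalCone j) :
    ‖f - shift (Pi.single j 1) f‖
      ≤ (1 / Real.pi) * ∫ η in Set.Icc (-Real.pi) Real.pi, ‖fourierCLM (Pi.single j η) f‖ := by
  have h1 : (2 * Real.pi) * ∑' x : Fin d → ℤ, (f x).re * (if x j = 0 then 1 else 0)
      ≤ ∫ η in Set.Icc (-Real.pi) Real.pi, ‖fourierCLM (Pi.single j η) f‖ := by
    refine le_trans ?_ (norm_integral_le_integral_norm _)
    rw [← slice_eq_integral]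
    refine le_trans (le_of_eq ?_) (Complex.re_le_norm _)
    rw [← tsum_mul_left, Complex.re_tsum]
    · refine tsum_congr fun x => ?_
      split_ifs
      · simp [(hf x).1]; ring
      · simp
    · refine Summable.of_norm_bounded ((summable_norm f).mul_right (2 * Real.pi)) fun x => ?_
      rw [norm_mul]
      gcongr
      split_ifs
      · simp [abs_of_pos Real.pi_pos]
      · simp [Real.pi_pos.le]
  rw [norm_sub_shift hf, one_div, inv_mul_eq_div, le_div_iff₀ Real.pi_pos]
  linarith

/-! ### Decay of the kernel and of its differences -/

/-- Keep one summand of the symbol and use Jordan's inequality `sin u ≥ 2u/π` on `[0, π/2]`. -/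
lemma abs_rpow_le_symbol_rpow {s : ℝ} (hs : 0 < s) {ξ : Fin d → ℝ} {j : Fin d}
    (hξ : |ξ j| ≤ Real.pi) : (2 / Real.pi) ^ (2 * s) * |ξ j| ^ (2 * s) ≤ symbol ξ ^ s := by
  have hpi := Real.pi_pos
  have h1 : 2 / Real.pi * |ξ j| ≤ 2 * Real.sin (|ξ j| / 2) := by
    have := Real.mul_le_sin (x := |ξ j| / 2) (by positivity) (by linarith)
    linarith
  have h2 : Real.sin (|ξ j| / 2) ^ 2 = Real.sin (ξ j / 2) ^ 2 := by
    rcases abs_choice (ξ j) with h | h <;> rw [h]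
    rw [neg_div, Real.sin_neg, neg_sq]
  have h3 : (2 / Real.pi * |ξ j|) ^ 2 ≤ symbol ξ := by
    have h4 : Real.sin (ξ j / 2) ^ 2 ≤ ∑ k, Real.sin (ξ k / 2) ^ 2 :=
      Finset.single_le_sum (f := fun k => Real.sin (ξ k / 2) ^ 2) (fun k _ => sq_nonneg _)
        (Finset.mem_univ j)
    have h5 := pow_le_pow_left₀ (by positivity) h1 2
    rw [mul_pow 2 (Real.sin _), h2] at h5
    unfold symbol
    linarith
  rw [← Real.mul_rpow (by positivity) (abs_nonneg _), Real.rpow_mul (by positivity)]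
  exact Real.rpow_le_rpow (by positivity) (by exact_mod_cast h3) hs.le

lemma setIntegral_exp_neg_mul_abs_rpow_le {p b : ℝ} (hp : 0 < p) (hb : 0 < b) (S : Set ℝ) :
    ∫ η in S, Real.exp (-(b * |η| ^ p)) ≤ 2 * Real.Gamma (1 / p + 1) * b ^ (-(1 / p)) := by
  have h : ∫ η : ℝ, Real.exp (-(b * |η| ^ p)) = 2 * Real.Gamma (1 / p + 1) * b ^ (-(1 / p)) := by
    rw [integral_comp_abs (f := fun η => Real.exp (-(b * η ^ p)))]
    have := integral_exp_neg_mul_rpow hp hb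
    simp only [neg_mul] at this
    rw [this, neg_div]
    ring
  have hpos : 0 < Real.Gamma (1 / p + 1) := Real.Gamma_pos_of_pos (by positivity)
  have hne : ∫ η : ℝ, Real.exp (-(b * |η| ^ p)) ≠ 0 := by
    rw [h]; positivity
  rw [← h]
  -- Integrability comes for free: a nonintegrable function would have integral `0`.
  exact setIntegral_le_integral (not_imp_comm.mp integral_undef hne)
    (Filter.Eventually.of_forall fun η => Real.exp_nonneg _)

lemma exists_norm_kernel_sub_shift_le (hd : 1 ≤ d) {s : ℝ} (hs : s ∈ Set.Ioc (0 : ℝ) 1) :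
    ∃ C : ℝ, 0 < C ∧ ∀ t : ℝ, 0 < t → ∀ j : Fin d,
      ‖kernel d s t - shift (Pi.single j 1) (kernel d s t)‖ ≤ C * t ^ (-(1 / (2 * s))) := by
  have hpi := Real.pi_pos
  have hs0 := hs.1
  have hG : 0 < Real.Gamma (1 / (2 * s) + 1) := Real.Gamma_pos_of_pos (by positivity)
  have hc : (0 : ℝ) < (2 / Real.pi) ^ (2 * s) := by positivity
  refine ⟨1 / Real.pi * (2 * Real.Gamma (1 / (2 * s) + 1) *
    ((2 / Real.pi) ^ (2 * s)) ^ (-(1 / (2 * s)))), by positivity, fun t ht j => ?_⟩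
  refine (norm_sub_shift_le (kernel_mem_unimodalCone hd hs ht.le j)).trans ?_
  rw [mul_assoc]
  refine mul_le_mul_of_nonneg_left ?_ (by positivity)
  calc ∫ η in Set.Icc (-Real.pi) Real.pi, ‖fourierCLM (Pi.single j η) (kernel d s t)‖
      ≤ ∫ η in Set.Icc (-Real.pi) Real.pi,
          Real.exp (-(t * (2 / Real.pi) ^ (2 * s) * |η| ^ (2 * s))) := by
        refine integral_mono_of_nonneg (Filter.Eventually.of_forall fun η => norm_nonneg _) ?_ ?_
        · refine Continuous.integrableOn_Icc ?_
          exact Real.continuous_exp.comp (continuous_const.mul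
            (continuous_abs.rpow_const fun _ => Or.inr (by positivity))).neg
        · filter_upwards [ae_restrict_mem measurableSet_Icc] with η hη
          rw [kernel, fourierCLM_heatOp hd hs, fourierCLM_single_zero, mul_one, Complex.norm_real,
            Real.norm_of_nonneg (Real.exp_nonneg _), Real.exp_le_exp, neg_le_neg_iff, mul_assoc]
          have := abs_rpow_le_symbol_rpow hs0 (ξ := Pi.single j η) (j := j)
            (by rw [Pi.single_eq_same]; exact abs_le.mpr hη)
          rw [Pi.single_eq_same] at this
          exact mul_le_mul_of_nonneg_left this ht.le
    _ ≤ 2 * Real.Gamma (1 / (2 * s) + 1) * (t * (2 / Real.pi) ^ (2 * s)) ^ (-(1 / (2 * s))) :=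
        setIntegral_exp_neg_mul_abs_rpow_le (by positivity) (by positivity) _
    _ = _ := by
        rw [Real.mul_rpow ht.le hc.le]
        ring

/-- Averaging the `d` one-coordinate lower bounds for the symbol gives a majorant that factorizes,
so the torus integral becomes a `d`-th power. -/
lemma exp_neg_symbol_le_prod (hd : 1 ≤ d) {s t : ℝ} (hs : 0 < s) (ht : 0 ≤ t) {ξ : Fin d → ℝ}
    (hξ : ξ ∈ torus d) : Real.exp (-(t * symbol ξ ^ s)) ≤
      ∏ j, Real.exp (-(t / d * (2 / Real.pi) ^ (2 * s) * |ξ j| ^ (2 * s))) := by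
  have hd' : (0 : ℝ) < d := by exact_mod_cast hd
  rw [← Real.exp_sum, Real.exp_le_exp, Finset.sum_neg_distrib, neg_le_neg_iff]
  calc ∑ j, t / d * (2 / Real.pi) ^ (2 * s) * |ξ j| ^ (2 * s)
      ≤ ∑ j : Fin d, t / d * symbol ξ ^ s := Finset.sum_le_sum fun j _ => by
        rw [mul_assoc]
        exact mul_le_mul_of_nonneg_left
          (abs_rpow_le_symbol_rpow hs (abs_le.mpr (hξ j (Set.mem_univ j)))) (by positivity)
    _ = t * symbol ξ ^ s := by
        simp only [Finset.sum_const, Finset.card_univ, Fintype.card_fin, nsmul_eq_mul]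
        field_simp

lemma exists_norm_kernel_apply_le (hd : 1 ≤ d) {s : ℝ} (hs : s ∈ Set.Ioc (0 : ℝ) 1) :
    ∃ C : ℝ, 0 < C ∧ ∀ t : ℝ, 0 < t → ∀ x : Fin d → ℤ,
      ‖kernel d s t x‖ ≤ C * t ^ (-((d : ℝ) / (2 * s))) := by
  have hpi := Real.pi_pos
  have hs0 := hs.1
  have hd' : (0 : ℝ) < d := by exact_mod_cast hd
  have hG : 0 < Real.Gamma (1 / (2 * s) + 1) := Real.Gamma_pos_of_pos (by positivity)
  set c : ℝ := (2 / Real.pi) ^ (2 * s) / d with hc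
  have hc0 : 0 < c := by positivity
  refine ⟨(1 / (2 * Real.pi) ^ d) * (2 * Real.Gamma (1 / (2 * s) + 1) * c ^ (-(1 / (2 * s)))) ^ d,
    by positivity, fun t ht x => ?_⟩
  rw [kernel_apply hd hs, heatKernel, norm_mul, mul_assoc]
  have hn : ‖(1 / (2 * (Real.pi : ℂ)) ^ d)‖ = 1 / (2 * Real.pi) ^ d := by
    simp [abs_of_pos hpi]
  rw [hn]
  refine mul_le_mul_of_nonneg_left ?_ (by positivity)
  have hexp : Continuous fun η : ℝ =>
      Real.exp (-(t / d * (2 / Real.pi) ^ (2 * s) * |η| ^ (2 * s))) :=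
    Real.continuous_exp.comp (continuous_const.mul
      (continuous_abs.rpow_const fun _ => Or.inr (by positivity))).neg
  calc _ ≤ ∫ ξ in torus d, ‖((Real.exp (-(t * symbol ξ ^ s)) : ℝ) : ℂ) *
          Complex.exp (Complex.I * (pairing x ξ : ℂ))‖ := norm_integral_le_integral_norm _
    _ ≤ ∫ ξ in torus d, ∏ j, Real.exp (-(t / d * (2 / Real.pi) ^ (2 * s) * |ξ j| ^ (2 * s))) := by
        refine integral_mono_of_nonneg (Filter.Eventually.of_forall fun ξ => norm_nonneg _) ?_ ?_
        · rw [volume_restrict_torus]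
          exact Integrable.fintype_prod (f := fun (_ : Fin d) (η : ℝ) =>
            Real.exp (-(t / d * (2 / Real.pi) ^ (2 * s) * |η| ^ (2 * s))))
            fun _ => hexp.integrableOn_Icc
        · filter_upwards [ae_restrict_mem (MeasurableSet.univ_pi fun _ => measurableSet_Icc)]
            with ξ hξ
          have h1 : ‖Complex.exp (Complex.I * (pairing x ξ : ℂ))‖ = 1 := by
            rw [Complex.norm_exp]; simp
          rw [norm_mul, h1, mul_one, Complex.norm_real, Real.norm_of_nonneg (Real.exp_nonneg _)]
          exact exp_neg_symbol_le_prod hd hs0 ht.le hξ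
    _ = (∫ η in Set.Icc (-Real.pi) Real.pi,
          Real.exp (-(t / d * (2 / Real.pi) ^ (2 * s) * |η| ^ (2 * s)))) ^ d := by
        rw [volume_restrict_torus, integral_fintype_prod_eq_pow (fun η : ℝ =>
          Real.exp (-(t / d * (2 / Real.pi) ^ (2 * s) * |η| ^ (2 * s)))), Fintype.card_fin]
    _ ≤ (2 * Real.Gamma (1 / (2 * s) + 1) *
          (t / d * (2 / Real.pi) ^ (2 * s)) ^ (-(1 / (2 * s)))) ^ d :=
        pow_le_pow_left₀ (integral_nonneg fun η => Real.exp_nonneg _)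
          (setIntegral_exp_neg_mul_abs_rpow_le (by positivity) (by positivity) _) _
    _ = _ := by
        have h1 : t / d * (2 / Real.pi) ^ (2 * s) = c * t := by rw [hc]; ring
        rw [h1, Real.mul_rpow hc0.le ht.le, ← mul_assoc, mul_pow _ (t ^ _),
          ← Real.rpow_mul_natCast ht.le]
        congr 2
        ring

/-! ### First-moment estimates and smoothing -/

/-- The first-moment estimate for translates: `‖f - S_y f‖₁ ≤ ∑ⱼ |yⱼ| ‖f - S_{eⱼ} f‖₁`. -/
lemma norm_sub_shift_le_sum (f : Ell d 1) (y : Fin d → ℤ) :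
    ‖f - shift y f‖ ≤ ∑ j, |(y j : ℝ)| * ‖f - shift (Pi.single j 1) f‖ := by
  have hadd (a b : Fin d → ℤ) : ‖f - shift (a + b) f‖ ≤ ‖f - shift a f‖ + ‖f - shift b f‖ := by
    have : f - shift (a + b) f = (f - shift a f) + shift a (f - shift b f) := by
      rw [map_sub, shift_add, mul_apply_eq_comp]
      abel
    rw [this]
    exact (norm_add_le _ _).trans_eq (by rw [norm_shift_apply])
  have hneg (a : Fin d → ℤ) : ‖f - shift (-a) f‖ = ‖f - shift a f‖ := by
    have : shift a (f - shift (-a) f) = -(f - shift a f) := by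
      rw [map_sub, ← mul_apply_eq_comp, ← shift_add, add_neg_cancel, shift_zero, neg_sub]
      rfl
    rw [← norm_shift_apply a, this, norm_neg]
  have hnat (j : Fin d) (n : ℕ) :
      ‖f - shift (Pi.single j (n : ℤ)) f‖ ≤ n * ‖f - shift (Pi.single j 1) f‖ := by
    induction n with
    | zero => simp [shift_zero]
    | succ n ih =>
      rw [Nat.cast_succ, Pi.single_add]
      refine (hadd _ _).trans ?_
      push_cast
      linarith
  have hint (j : Fin d) (n : ℤ) :
      ‖f - shift (Pi.single j n) f‖ ≤ |(n : ℝ)| * ‖f - shift (Pi.single j 1) f‖ := by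
    rcases Int.natAbs_eq n with h | h
    · have h2 : |(n : ℝ)| = n.natAbs := by rw [Nat.cast_natAbs]; push_cast; rfl
      rw [h2, h]
      simpa using hnat j n.natAbs
    · have h2 : |(n : ℝ)| = n.natAbs := by rw [Nat.cast_natAbs]; push_cast; rfl
      rw [h2, h, Pi.single_neg, hneg]
      simpa using hnat j n.natAbs
  have hsum (S : Finset (Fin d)) : ‖f - shift (∑ j ∈ S, Pi.single j (y j)) f‖
      ≤ ∑ j ∈ S, |(y j : ℝ)| * ‖f - shift (Pi.single j 1) f‖ := by
    induction S using Finset.induction_on with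
    | empty => simp [shift_zero]
    | insert j S hj ih =>
      rw [Finset.sum_insert hj, Finset.sum_insert hj]
      exact (hadd _ _).trans (add_le_add (hint j _) ih)
  simpa [Finset.univ_sum_single] using hsum Finset.univ

lemma abs_le_euclid (y : Fin d → ℤ) (j : Fin d) : |(y j : ℝ)| ≤ euclid y := by
  rw [euclid, ← Real.sqrt_sq_eq_abs]
  exact Real.sqrt_le_sqrt (Finset.single_le_sum (f := fun k => (y k : ℝ) ^ 2)
    (fun k _ => sq_nonneg _) (Finset.mem_univ j))

lemma hasSum_heatOp_sub (hd : 1 ≤ d) {s : ℝ} (hs : s ∈ Set.Ioc (0 : ℝ) 1) (t : ℝ) (f : Ell d 1) :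
    HasSum (fun y => f y • (shift y (kernel d s t) - kernel d s t))
      (heatOp d s t f - mass f • kernel d s t) := by
  have h := (summable_norm f).of_norm.hasSum.smul_const (kernel d s t)
  simp only [smul_sub]
  exact (hasSum_heatOp hd hs t f).sub h

lemma norm_heatOp_sub_le (hd : 1 ≤ d) {s : ℝ} (hs : s ∈ Set.Ioc (0 : ℝ) 1) {t B : ℝ} {f : Ell d 1}
    (hf : HasFiniteFirstMoment f)
    (hB : ∀ j, ‖kernel d s t - shift (Pi.single j 1) (kernel d s t)‖ ≤ B) :
    ‖heatOp d s t f - mass f • kernel d s t‖ ≤ d * B * firstMoment f := by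
  rw [← (hasSum_heatOp_sub hd hs t f).tsum_eq, firstMoment, ← tsum_mul_left]
  refine tsum_of_norm_bounded (hf.mul_left (d * B)).hasSum fun y => ?_
  rw [norm_smul, norm_sub_rev]
  have h : ‖kernel d s t - shift y (kernel d s t)‖ ≤ d * (euclid y * B) := by
    refine (norm_sub_shift_le_sum _ y).trans ?_
    calc _ ≤ ∑ j : Fin d, euclid y * B := Finset.sum_le_sum fun j _ =>
          mul_le_mul (abs_le_euclid y j) (hB j) (norm_nonneg _) (Real.sqrt_nonneg _)
      _ = _ := by simp
  calc _ ≤ ‖f y‖ * (d * (euclid y * B)) := mul_le_mul_of_nonneg_left h (norm_nonneg _)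
    _ = _ := by ring

lemma norm_heatOp_apply_le (hd : 1 ≤ d) {s : ℝ} (hs : s ∈ Set.Ioc (0 : ℝ) 1) {t B : ℝ}
    (hB : ∀ x, ‖kernel d s t x‖ ≤ B) (f : Ell d 1) (x : Fin d → ℤ) :
    ‖heatOp d s t f x‖ ≤ B * ‖f‖ := by
  have h := (hasSum_heatOp hd hs t f).mapL (lp.evalCLM ℂ (fun _ : Fin d → ℤ => ℂ) (p := 1) x)
  have h1 : heatOp d s t f x = ∑' y, f y * kernel d s t (x - y) := h.tsum_eq.symm
  rw [h1, norm_eq_tsum, ← tsum_mul_left]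
  refine tsum_of_norm_bounded ((summable_norm f).mul_left B).hasSum fun y => ?_
  rw [norm_mul, mul_comm]
  exact mul_le_mul_of_nonneg_right (hB _) (norm_nonneg _)

/-! ### Interpolation and the asymptotic bounds -/

lemma norm_infty_le_of_forall_le {F : (Fin d → ℤ) → ℂ} {S : ℝ} (hS : ∀ x, ‖F x‖ ≤ S) :
    ∃ h : Memℓp F ⊤, ‖(⟨F, h⟩ : Ell d ⊤)‖ ≤ S :=
  ⟨memℓp_infty ⟨S, by rintro _ ⟨x, rfl⟩; exact hS x⟩,
    lp.norm_le_of_forall_le ((norm_nonneg _).trans (hS 0)) hS⟩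

/-- The interpolation inequality `‖f‖_p ≤ ‖f‖₁^{1/p} ‖f‖_∞^{1-1/p}`. -/
lemma norm_le_rpow_mul_rpow (f : Ell d 1) {S : ℝ} (hS : ∀ x, ‖f x‖ ≤ S) {p : ENNReal}
    (hp : 1 ≤ p) (hp' : p ≠ ⊤) :
    ∃ h : Memℓp (f : (Fin d → ℤ) → ℂ) p, ‖(⟨f, h⟩ : Ell d p)‖
      ≤ ‖f‖ ^ (p⁻¹).toReal * S ^ (1 - (p⁻¹).toReal) := by
  have hS0 : 0 ≤ S := (norm_nonneg _).trans (hS 0)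
  have hq : 1 ≤ p.toReal := by simpa using ENNReal.toReal_mono hp' hp
  have hq0 : 0 < p.toReal := by linarith
  refine ⟨(lp.memℓp f).of_exponent_ge hp, ?_⟩
  refine lp.norm_le_of_tsum_le hq0 (by positivity) ?_
  have hle (x : Fin d → ℤ) : ‖f x‖ ^ p.toReal ≤ ‖f x‖ * S ^ (p.toReal - 1) := by
    calc ‖f x‖ ^ p.toReal = ‖f x‖ ^ (1 + (p.toReal - 1)) := by rw [add_sub_cancel]
      _ = ‖f x‖ * ‖f x‖ ^ (p.toReal - 1) := by
          rw [Real.rpow_add_of_nonneg (norm_nonneg _) zero_le_one (by linarith), Real.rpow_one]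
      _ ≤ _ := by gcongr; exact hS x
  have hsum := (summable_norm f).mul_right (S ^ (p.toReal - 1))
  calc ∑' x, ‖f x‖ ^ p.toReal ≤ ∑' x, ‖f x‖ * S ^ (p.toReal - 1) :=
        (Summable.of_nonneg_of_le (fun x => by positivity) hle hsum).tsum_le_tsum hle hsum
    _ = ‖f‖ * S ^ (p.toReal - 1) := by rw [tsum_mul_right, ← norm_eq_tsum]
    _ = _ := by
        rw [Real.mul_rpow (by positivity) (by positivity), ← Real.rpow_mul (norm_nonneg _),
          ← Real.rpow_mul hS0, ENNReal.toReal_inv, inv_mul_cancel₀ hq0.ne', Real.rpow_one, sub_mul,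
          inv_mul_cancel₀ hq0.ne', one_mul]

/-- The weight `t^{α(1-1/p)}` is absorbed by the factor `S^{1-1/p}` of the interpolation inequality,
leaving `K^{1/p} K^{1-1/p}`; hence one constant serves all `p`. -/
lemma rpow_mul_norm_le (f : Ell d 1) {F : (Fin d → ℤ) → ℂ} (hF : F = f) {t α K S : ℝ} (ht : 0 < t)
    (h1 : ‖f‖ ≤ K) (hS : ∀ x, ‖f x‖ ≤ S) (hSK : t ^ α * S ≤ K) {p : ENNReal} (hp : 1 ≤ p) :
    ∃ h : Memℓp F p, t ^ (α * (1 - (p⁻¹).toReal)) * ‖(⟨F, h⟩ : Ell d p)‖ ≤ K := by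
  subst hF
  have hS0 : 0 ≤ S := (norm_nonneg _).trans (hS 0)
  have hK : 0 ≤ K := (norm_nonneg _).trans h1
  rcases eq_or_ne p ⊤ with rfl | hp'
  · obtain ⟨h, hle⟩ := norm_infty_le_of_forall_le hS
    refine ⟨h, ?_⟩
    simp only [ENNReal.inv_top, ENNReal.toReal_zero, sub_zero, mul_one]
    exact (mul_le_mul_of_nonneg_left hle (by positivity)).trans hSK
  · obtain ⟨h, hle⟩ := norm_le_rpow_mul_rpow f hS hp hp'
    refine ⟨h, ?_⟩
    set θ := (p⁻¹).toReal with hθ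
    have hθ0 : 0 ≤ θ := ENNReal.toReal_nonneg
    have hθ1 : 0 ≤ 1 - θ := by
      have : θ ≤ 1 := by
        simpa [hθ] using ENNReal.toReal_mono ENNReal.one_ne_top (ENNReal.inv_le_one.mpr hp)
      linarith
    calc t ^ (α * (1 - θ)) * ‖(⟨f, h⟩ : Ell d p)‖
        ≤ t ^ (α * (1 - θ)) * (‖f‖ ^ θ * S ^ (1 - θ)) := by gcongr
      _ = ‖f‖ ^ θ * (t ^ α * S) ^ (1 - θ) := by
          rw [Real.mul_rpow (by positivity) hS0, ← Real.rpow_mul ht.le]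
          ring
      _ ≤ K ^ θ * K ^ (1 - θ) := by gcongr
      _ = K := by
          rw [← Real.rpow_add_of_nonneg hK hθ0 hθ1, add_sub_cancel, Real.rpow_one]

lemma heatOp_sub_eq (s t : ℝ) (f : Ell d 1) :
    heatOp d s t f - mass f • kernel d s t =
      heatOp d s (t / 2) (heatOp d s (t / 2) f - mass f • kernel d s (t / 2)) := by
  rw [map_sub, map_smul, kernel, kernel, ← mul_apply_eq_comp, ← mul_apply_eq_comp, ← heatOp_add,
    add_halves]

lemma exists_asymptotic_bound (hd : 1 ≤ d) {s : ℝ} (hs : s ∈ Set.Ioc (0 : ℝ) 1) :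
    ∃ C : ℝ, 0 < C ∧ ∀ f : Ell d 1, HasFiniteFirstMoment f → ∀ t : ℝ, 0 < t →
      ‖heatOp d s t f - mass f • kernel d s t‖ ≤ C * firstMoment f * t ^ (-(1 / (2 * s))) ∧
      ∃ S : ℝ, (∀ x, ‖(heatOp d s t f - mass f • kernel d s t) x‖ ≤ S) ∧
        t ^ ((d : ℝ) / (2 * s)) * S ≤ C * firstMoment f * t ^ (-(1 / (2 * s))) := by
  obtain ⟨C₁, hC₁, h₁⟩ := exists_norm_kernel_sub_shift_le hd hs
  obtain ⟨C₂, hC₂, h₂⟩ := exists_norm_kernel_apply_le hd hs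
  have hd' : (0 : ℝ) < d := by exact_mod_cast hd
  set a : ℝ := 2⁻¹ ^ (-((d : ℝ) / (2 * s))) with ha
  set b : ℝ := 2⁻¹ ^ (-(1 / (2 * s))) with hb
  have ha0 : 0 < a := by positivity
  have hb0 : 0 < b := by positivity
  -- The first summand serves `ℓ¹`, the second `ℓ^∞`; `a` and `b` are the costs of replacing `t` by
  -- `t/2` in the two powers.
  refine ⟨d * C₁ + C₂ * a * (d * C₁ * b), by positivity, fun f hf t ht => ?_⟩
  have hN : 0 ≤ firstMoment f :=
    tsum_nonneg fun x => mul_nonneg (Real.sqrt_nonneg _) (norm_nonneg _)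
  set τ : ℝ := t ^ (-(1 / (2 * s))) with hτ
  have hτ0 : 0 < τ := by positivity
  constructor
  · refine (norm_heatOp_sub_le hd hs hf (h₁ t ht)).trans ?_
    have : 0 ≤ C₂ * a * (d * C₁ * b) * firstMoment f * τ := by positivity
    linarith
  have hhalf (r : ℝ) : (t / 2) ^ r = 2⁻¹ ^ r * t ^ r := by
    rw [div_eq_inv_mul, Real.mul_rpow (by norm_num) ht.le]
  refine ⟨C₂ * (t / 2) ^ (-((d : ℝ) / (2 * s))) *
    (d * (C₁ * (t / 2) ^ (-(1 / (2 * s)))) * firstMoment f), fun x => ?_, ?_⟩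
  · rw [heatOp_sub_eq]
    refine (norm_heatOp_apply_le hd hs (h₂ (t / 2) (half_pos ht)) _ x).trans ?_
    exact mul_le_mul_of_nonneg_left (norm_heatOp_sub_le hd hs hf (h₁ (t / 2) (half_pos ht)))
      (by positivity)
  · rw [hhalf, hhalf, ← ha, ← hb, ← hτ]
    have h3 : t ^ ((d : ℝ) / (2 * s)) * t ^ (-((d : ℝ) / (2 * s))) = 1 := by
      rw [← Real.rpow_add ht, add_neg_cancel, Real.rpow_zero]
    calc _ = (t ^ ((d : ℝ) / (2 * s)) * t ^ (-((d : ℝ) / (2 * s)))) *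
          (C₂ * a * (d * C₁ * b) * firstMoment f * τ) := by ring
      _ ≤ _ := by
        rw [h3, one_mul]
        have : 0 ≤ d * C₁ * firstMoment f * τ := by positivity
        linarith

end LatticeDiffusion

end

theorem theorem1p3 (d : ℕ) (hd : 1 ≤ d) (s : ℝ) (hs : s ∈ Set.Ioc (0 : ℝ) 1) :
    -- the Cauchy problem is well posed in `ℓ¹`, and its solution is `G_t * u₀`
    (∀ u₀ : LatticeDiffusion.Ell d 1,
      (∃ u : ℝ → LatticeDiffusion.Ell d 1, LatticeDiffusion.IsSolution s u₀ u) ∧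
      ∀ u : ℝ → LatticeDiffusion.Ell d 1, LatticeDiffusion.IsSolution s u₀ u →
        ∀ t : ℝ, 0 ≤ t → ∀ x : Fin d → ℤ,
          u t x = LatticeDiffusion.conv (LatticeDiffusion.heatKernel s t) u₀ x) ∧
    -- the first-order asymptotics, with a constant that depends on `d` and `s` only
    ∃ C : ℝ, 0 < C ∧
      ∀ (u₀ : LatticeDiffusion.Ell d 1), LatticeDiffusion.HasFiniteFirstMoment u₀ →
      ∀ (u : ℝ → LatticeDiffusion.Ell d 1), LatticeDiffusion.IsSolution s u₀ u →
      ∀ t : ℝ, 0 < t →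
        (∃ h : Memℓp (fun x : Fin d → ℤ =>
            u t x - LatticeDiffusion.mass u₀ * LatticeDiffusion.heatKernel s t x) ⊤,
          t ^ ((d : ℝ) / (2 * s)) * ‖(⟨_, h⟩ : LatticeDiffusion.Ell d ⊤)‖
            ≤ C * LatticeDiffusion.firstMoment u₀ * t ^ (-(1 / (2 * s)))) ∧
        (∃ h : Memℓp (fun x : Fin d → ℤ =>
            u t x - LatticeDiffusion.mass u₀ * LatticeDiffusion.heatKernel s t x) 1,
          ‖(⟨_, h⟩ : LatticeDiffusion.Ell d 1)‖
            ≤ C * LatticeDiffusion.firstMoment u₀ * t ^ (-(1 / (2 * s)))) ∧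
        (∀ p : ENNReal, 1 ≤ p →
          ∃ h : Memℓp (fun x : Fin d → ℤ =>
            u t x - LatticeDiffusion.mass u₀ * LatticeDiffusion.heatKernel s t x) p,
          t ^ ((d : ℝ) / (2 * s) * (1 - (p⁻¹).toReal)) * ‖(⟨_, h⟩ : LatticeDiffusion.Ell d p)‖
            ≤ C * LatticeDiffusion.firstMoment u₀ * t ^ (-(1 / (2 * s)))) := by
  refine ⟨fun u₀ => ⟨⟨_, LatticeDiffusion.isSolution_heatOp hd hs u₀⟩, fun u hu t ht x => ?_⟩, ?_⟩
  · rw [hu.eq_heatOp hd hs ht, LatticeDiffusion.heatOp_apply hd hs]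
  obtain ⟨C, hC, h⟩ := LatticeDiffusion.exists_asymptotic_bound hd hs
  refine ⟨C, hC, fun u₀ hu₀ u hu t ht => ?_⟩
  obtain ⟨h1, S, hS, hSK⟩ := h u₀ hu₀ t ht
  have hF : (fun x : Fin d → ℤ =>
      u t x - LatticeDiffusion.mass u₀ * LatticeDiffusion.heatKernel s t x) =
      ⇑(LatticeDiffusion.heatOp d s t u₀ -
        LatticeDiffusion.mass u₀ • LatticeDiffusion.kernel d s t) := by
    funext x
    rw [hu.eq_heatOp hd hs ht.le, ← LatticeDiffusion.kernel_apply hd hs]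
    rfl
  have key := fun (p : ENNReal) (hp : 1 ≤ p) =>
    LatticeDiffusion.rpow_mul_norm_le _ hF ht h1 hS hSK hp
  refine ⟨?_, ?_, key⟩
  · simpa using key ⊤ le_top
  · simpa using key 1 le_rfl
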